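/- A \emph{flow} on a category $\mathcal C$ is a functor $\varepsilon\mapsto T_\varepsilon$ from the poset $[0,\infty)$ to endofunctors of $\mathcal C$ with natural transformations $\mathrm{Id}\Rightarrow T_0$ and $T_\varepsilon T_\delta\Rightarrow T_{\varepsilon+\delta}$ that are unital, associative and compatible with the maps $T_{\delta}\Rightarrow T_{\varepsilon}$ ($\delta\le\varepsilon$); it is \emph{strict} if these transformations are identities. A \emph{coflow} is the dual notion, with structure maps $T_\varepsilon\Rightarrow T_\delta$ ($\delta\le\varepsilon$), $T_0\Rightarrow\mathrm{Id}$ and $T_{\varepsilon+\delta}\Rightarrow T_\varepsilon T_\delta$; thus a flow on $\mathcal C$ is the same as a coflow on $\mathcal C^{op}$. In a category with a coflow, $A$ and $B$ are weakly $\varepsilon$-interleaved if there are $\alpha:T_\varepsilon A\to B$ and $\beta:T_\varepsilon B\to A$ such that $T_{2\varepsilon}A\to T_\varepsilon T_\varepsilon A\xrightarrow{T_\varepsilon\alpha}T_\varepsilon B\xrightarrow{\beta}A$ equals $T_{2\varepsilon}A\to T_0A\to A$, and likewise with $(A,\alpha)$ and $(B,\beta)$ exchanged. The interleaving distance $d(A,B)\in[0,\infty]$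 is the infimum of all such $\varepsilon$ ($\infty$ if there are none). The category is \emph{metrically complete} if every sequence of objects that is Cauchy for $d$ has a limit for $d$. Let $\mathcal C$ be a small category with a strict coflow $(T_\varepsilon)$, let $h:\mathcal C\to[\mathcal C^{op},\mathbf{Set}]$ be the Yoneda embedding, and for every $\varepsilon\ge 0$ let $L_\varepsilon$ be a left Kan extension of $h\circ T_\varepsilon$ along $h$, with the coflow structure $L_\varepsilon\Rightarrow L_\delta$, $L_0\Rightarrow\mathrm{Id}$, $L_{\varepsilon+\delta}\Rightarrow L_\varepsilon L_\delta$ on $[\mathcal C^{op},\mathbf{Set}]$ induced from that of $T$ by the universal properties. Then there is a full subcategory $\overline{\mathcal C}$ of $[\mathcal C^{op},\mathbf{Set}]$ such that \begin{enumerate} \item $\mathcal C$ is, via $h$, a full subcategory of $\overline{\mathcal C}$; \item $\mathcal C$ is metrically dense in $\overline{\mathcal C}$: for every object $Z$ of $\overline{\mathcal C}$ and every real $\varepsilon>0$ there is an object $A$ of $\mathcal C$ with $d(h(A),Z)<\varepsilon$; \item every $L_\varepsilon$ preserves $\overline{\mathcal C}$; \item $(\overline{\mathcal C},L_\varepsilon)$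 is metrically complete; \item $\overline{\mathcal C}$ is the largest full subcategory of $[\mathcal C^{op},\mathbf{Set}]$ with properties 1--4. \end{enumerate} Dually, if $\mathcal C$ is a small category with a strict flow $(T_\varepsilon)$, the same holds for the category $\mathcal C^{op}$ with the strict coflow $(T_\varepsilon^{op})$. -/

import Mathlib

open CategoryTheory Opposite
open scoped NNReal ENNReal

universe v₁ v₂ u₁ u₂

/-- A category with a flow: a functor `T` from the poset `[0, ∞)` to endofunctors of `C`, together
with a unit `Id ⟶ T₀` and a multiplication `T_ε T_δ ⟶ T_{ε+δ}` that are unital, associative and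
natural in the indices.  Composites of endofunctors are in diagrammatic order, so `T_ε T_δ`,
which sends `A` to `T_ε (T_δ A)`, is `shift δ ⋙ shift ε`.  Where two indices are equal but not
syntactically the same, the transition map between them (an identity) is inserted. -/
structure CatFlow (C : Type u₁) [Category.{v₁} C] where
  shift : ℝ≥0 → C ⥤ C
  trans : ∀ {δ ε : ℝ≥0}, δ ≤ ε → (shift δ ⟶ shift ε)
  trans_refl : ∀ ε : ℝ≥0, trans (le_refl ε) = 𝟙 (shift ε)
  trans_comp : ∀ {δ ε ζ : ℝ≥0} (h₁ : δ ≤ ε) (h₂ : ε ≤ ζ),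
    trans h₁ ≫ trans h₂ = trans (h₁.trans h₂)
  unit : 𝟭 C ⟶ shift 0
  mult : ∀ ε δ : ℝ≥0, shift δ ⋙ shift ε ⟶ shift (ε + δ)
  unit_left : ∀ (ε : ℝ≥0) (A : C),
    unit.app ((shift ε).obj A) ≫ (mult 0 ε).app A = (trans (zero_add ε).ge).app A
  unit_right : ∀ (ε : ℝ≥0) (A : C),
    (shift ε).map (unit.app A) ≫ (mult ε 0).app A = (trans (add_zero ε).ge).app A
  assoc : ∀ (ε ζ δ : ℝ≥0) (A : C),
    (mult ε ζ).app ((shift δ).obj A) ≫ (mult (ε + ζ) δ).app A =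
      (shift ε).map ((mult ζ δ).app A) ≫ (mult ε (ζ + δ)).app A ≫
        (trans (add_assoc ε ζ δ).ge).app A
  mult_natural : ∀ {ε δ ζ κ : ℝ≥0} (h₁ : ε ≤ δ) (h₂ : ζ ≤ κ) (A : C),
    (mult ε ζ).app A ≫ (trans (add_le_add h₁ h₂)).app A =
      (trans h₁).app ((shift ζ).obj A) ≫ (shift δ).map ((trans h₂).app A) ≫ (mult δ κ).app A

/-- A flow is strict if its unit and its multiplications are identities. -/
structure CatFlow.IsStrict {C : Type u₁} [Category.{v₁} C] (T : CatFlow C) : Prop where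
  shift_zero : 𝟭 C = T.shift 0
  unit_eq : T.unit = eqToHom shift_zero
  shift_add : ∀ ε δ : ℝ≥0, T.shift δ ⋙ T.shift ε = T.shift (ε + δ)
  mult_eq : ∀ ε δ : ℝ≥0, T.mult ε δ = eqToHom (shift_add ε δ)

/-- A category with a coflow: the notion dual to that of a category with a flow, all structure
maps being reversed. -/
structure CatCoflow (C : Type u₁) [Category.{v₁} C] where
  shift : ℝ≥0 → C ⥤ C
  trans : ∀ {δ ε : ℝ≥0}, δ ≤ ε → (shift ε ⟶ shift δ)
  trans_refl : ∀ ε : ℝ≥0, trans (le_refl ε) = 𝟙 (shift ε)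
  trans_comp : ∀ {δ ε ζ : ℝ≥0} (h₁ : δ ≤ ε) (h₂ : ε ≤ ζ),
    trans h₂ ≫ trans h₁ = trans (h₁.trans h₂)
  counit : shift 0 ⟶ 𝟭 C
  comult : ∀ ε δ : ℝ≥0, shift (ε + δ) ⟶ shift δ ⋙ shift ε
  counit_left : ∀ (ε : ℝ≥0) (A : C),
    (comult 0 ε).app A ≫ counit.app ((shift ε).obj A) = (trans (zero_add ε).ge).app A
  counit_right : ∀ (ε : ℝ≥0) (A : C),
    (comult ε 0).app A ≫ (shift ε).map (counit.app A) = (trans (add_zero ε).ge).app A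
  coassoc : ∀ (ε ζ δ : ℝ≥0) (A : C),
    (comult (ε + ζ) δ).app A ≫ (comult ε ζ).app ((shift δ).obj A) =
      (trans (add_assoc ε ζ δ).ge).app A ≫ (comult ε (ζ + δ)).app A ≫
        (shift ε).map ((comult ζ δ).app A)
  comult_natural : ∀ {ε δ ζ κ : ℝ≥0} (h₁ : ε ≤ δ) (h₂ : ζ ≤ κ) (A : C),
    (trans (add_le_add h₁ h₂)).app A ≫ (comult ε ζ).app A =
      (comult δ κ).app A ≫ (shift δ).map ((trans h₂).app A) ≫ (trans h₁).app ((shift ζ).obj A)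

/-- A coflow is strict if its counit and its comultiplications are identities. -/
structure CatCoflow.IsStrict {C : Type u₁} [Category.{v₁} C] (T : CatCoflow C) : Prop where
  shift_zero : T.shift 0 = 𝟭 C
  counit_eq : T.counit = eqToHom shift_zero
  shift_add : ∀ ε δ : ℝ≥0, T.shift (ε + δ) = T.shift δ ⋙ T.shift ε
  comult_eq : ∀ ε δ : ℝ≥0, T.comult ε δ = eqToHom (shift_add ε δ)

/-- A flow on `C` is the same thing as a coflow on `Cᵒᵖ`. -/
def CatFlow.op {C : Type u₁} [Category.{v₁} C] (T : CatFlow C) : CatCoflow Cᵒᵖ where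
  shift ε := (T.shift ε).op
  trans h := NatTrans.op (T.trans h)
  trans_refl ε := by rw [T.trans_refl]; rfl
  trans_comp h₁ h₂ := by rw [← T.trans_comp h₁ h₂]; rfl
  counit := NatTrans.op T.unit
  comult ε δ := NatTrans.op (T.mult ε δ)
  counit_left ε A := Quiver.Hom.unop_inj (T.unit_left ε A.unop)
  counit_right ε A := Quiver.Hom.unop_inj (T.unit_right ε A.unop)
  coassoc ε ζ δ A := Quiver.Hom.unop_inj (by simpa using T.assoc ε ζ δ A.unop)
  comult_natural h₁ h₂ A := Quiver.Hom.unop_inj (by simpa using T.mult_natural h₁ h₂ A.unop)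

namespace CatCoflow

section Metric

variable {C : Type u₁} [Category.{v₁} C] (T : CatCoflow C)

/-- `α : T_ε A ⟶ B` and `β : T_ε B ⟶ A` make one triangle of a weak `ε`-interleaving commute:
the composite `T_{2ε} A ⟶ T_ε T_ε A ⟶ T_ε B ⟶ A` is `T_{2ε} A ⟶ T₀ A ⟶ A`. -/
def InterleavingTriangle (ε : ℝ≥0) {A B : C} (α : (T.shift ε).obj A ⟶ B)
    (β : (T.shift ε).obj B ⟶ A) : Prop :=
  (T.comult ε ε).app A ≫ (T.shift ε).map α ≫ β =
    (T.trans (show 0 ≤ ε + ε from bot_le)).app A ≫ T.counit.app A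

/-- `A` and `B` are weakly `ε`-interleaved. -/
def WeaklyInterleaved (ε : ℝ≥0) (A B : C) : Prop :=
  ∃ (α : (T.shift ε).obj A ⟶ B) (β : (T.shift ε).obj B ⟶ A),
    T.InterleavingTriangle ε α β ∧ T.InterleavingTriangle ε β α

/-- The interleaving distance; it is `∞` if there is no weak interleaving. -/
noncomputable def interleavingDist (A B : C) : ℝ≥0∞ :=
  ⨅ (ε : ℝ≥0) (_ : T.WeaklyInterleaved ε A B), (ε : ℝ≥0∞)

def IsCauchySeq (A : ℕ → C) : Prop :=
  ∀ ε : ℝ≥0, 0 < ε → ∃ N : ℕ, ∀ n m : ℕ, N ≤ n → N ≤ m →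
    T.interleavingDist (A n) (A m) < ε

def IsMetricLimit (A : ℕ → C) (L : C) : Prop :=
  ∀ ε : ℝ≥0, 0 < ε → ∃ N : ℕ, ∀ n : ℕ, N < n → T.interleavingDist (A n) L < ε

def IsMetricallyComplete : Prop :=
  ∀ A : ℕ → C, T.IsCauchySeq A → ∃ L : C, T.IsMetricLimit A L

end Metric

/-- A full subcategory `P` is preserved by the functors of a coflow. -/
def Preserves {D : Type u₂} [Category.{v₂} D] (S : CatCoflow D) (P : ObjectProperty D) : Prop :=
  ∀ (ε : ℝ≥0) (X : D), P X → P ((S.shift ε).obj X)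

/-- The coflow induced on a full subcategory that is preserved by a coflow. -/
def restrict {D : Type u₂} [Category.{v₂} D] (S : CatCoflow D) (P : ObjectProperty D)
    (hP : S.Preserves P) : CatCoflow P.FullSubcategory where
  shift ε := P.lift (P.ι ⋙ S.shift ε) fun X => hP ε X.obj X.property
  trans h :=
    { app := fun X => ObjectProperty.homMk ((S.trans h).app X.obj)
      naturality := fun _ _ f => P.hom_ext ((S.trans h).naturality f.hom) }
  trans_refl ε := by
    ext X
    exact congrArg (fun t => t.app X.obj) (S.trans_refl ε)
  trans_comp h₁ h₂ := by
    ext X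
    exact congrArg (fun t => t.app X.obj) (S.trans_comp h₁ h₂)
  counit :=
    { app := fun X => ObjectProperty.homMk (S.counit.app X.obj)
      naturality := fun _ _ f => P.hom_ext (S.counit.naturality f.hom) }
  comult ε δ :=
    { app := fun X => ObjectProperty.homMk ((S.comult ε δ).app X.obj)
      naturality := fun _ _ f => P.hom_ext ((S.comult ε δ).naturality f.hom) }
  counit_left ε X := P.hom_ext (S.counit_left ε X.obj)
  counit_right ε X := P.hom_ext (S.counit_right ε X.obj)
  coassoc ε ζ δ X := P.hom_ext (S.coassoc ε ζ δ X.obj)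
  comult_natural h₁ h₂ X := P.hom_ext (S.comult_natural h₁ h₂ X.obj)

section Extension

variable {C : Type u₁} [Category.{v₁} C] {D : Type u₂} [Category.{v₂} D]
  (T : CatCoflow C) (h : C ⥤ D) (L : ℝ≥0 → D ⥤ D) (η : ∀ ε, T.shift ε ⋙ h ⟶ h ⋙ L ε)
  [∀ ε, (L ε).IsLeftKanExtension (η ε)]

/-- `L_ε ⟶ L_δ` for `δ ≤ ε`, from the universal property of the left Kan extension `L_ε`. -/
noncomputable def lanTrans {δ ε : ℝ≥0} (hδε : δ ≤ ε) : L ε ⟶ L δ :=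
  (L ε).descOfIsLeftKanExtension (η ε) (L δ) (Functor.whiskerRight (T.trans hδε) h ≫ η δ)

/-- `L₀ ⟶ Id`, from the universal property of the left Kan extension `L₀`. -/
noncomputable def lanCounit : L 0 ⟶ 𝟭 D :=
  (L 0).descOfIsLeftKanExtension (η 0) (𝟭 D)
    { app := fun A => h.map (T.counit.app A)
      naturality := fun A B f => by
        have h₁ := congrArg h.map (T.counit.naturality f)
        rwa [h.map_comp, h.map_comp] at h₁ }

/-- `L_{ε+δ} ⟶ L_ε L_δ`, from the universal property of the left Kan extension `L_{ε+δ}` and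
`h T_{ε+δ} ⟶ h T_ε T_δ ⟶ L_ε h T_δ ⟶ L_ε L_δ h`. -/
noncomputable def lanComult (ε δ : ℝ≥0) : L (ε + δ) ⟶ L δ ⋙ L ε :=
  (L (ε + δ)).descOfIsLeftKanExtension (η (ε + δ)) (L δ ⋙ L ε)
    { app := fun A => h.map ((T.comult ε δ).app A) ≫ (η ε).app ((T.shift δ).obj A) ≫
        (L ε).map ((η δ).app A)
      naturality := fun A B f => by
        have h₁ := congrArg h.map ((T.comult ε δ).naturality f)
        have h₂ := (η ε).naturality ((T.shift δ).map f)
        have h₃ := congrArg (L ε).map ((η δ).naturality f)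
        simp only [Functor.comp_map, Functor.map_comp, Functor.comp_obj] at h₁ h₂ h₃
        simp only [Functor.comp_map, Functor.comp_obj, Category.assoc]
        rw [reassoc_of% h₁, reassoc_of% h₂, h₃] }

theorem lanTrans_fac {δ ε : ℝ≥0} (hδε : δ ≤ ε) (A : C) :
    (η ε).app A ≫ (T.lanTrans h L η hδε).app (h.obj A) =
      h.map ((T.trans hδε).app A) ≫ (η δ).app A :=
  (L ε).descOfIsLeftKanExtension_fac_app (η ε) _ _ A

theorem lanCounit_fac (A : C) :
    (η 0).app A ≫ (T.lanCounit h L η).app (h.obj A) = h.map (T.counit.app A) :=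
  (L 0).descOfIsLeftKanExtension_fac_app (η 0) _ _ A

theorem lanComult_fac (ε δ : ℝ≥0) (A : C) :
    (η (ε + δ)).app A ≫ (T.lanComult h L η ε δ).app (h.obj A) =
      h.map ((T.comult ε δ).app A) ≫ (η ε).app ((T.shift δ).obj A) ≫ (L ε).map ((η δ).app A) :=
  (L (ε + δ)).descOfIsLeftKanExtension_fac_app (η (ε + δ)) _ _ A

theorem lan_hom_ext (ε : ℝ≥0) {G : D ⥤ D} (f g : L ε ⟶ G)
    (hfg : ∀ A : C, (η ε).app A ≫ f.app (h.obj A) = (η ε).app A ≫ g.app (h.obj A)) : f = g :=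
  (L ε).hom_ext_of_isLeftKanExtension (η ε) f g (by ext A; exact hfg A)

/-- If every `L_ε` is a left Kan extension of `h T_ε` along `h : C ⥤ D`, then the coflow `T` on `C`
induces a coflow on `D` with functors `L_ε`. -/
noncomputable def lan : CatCoflow D where
  shift := L
  trans hδε := T.lanTrans h L η hδε
  trans_refl ε := by
    refine lan_hom_ext T h L η ε _ _ fun A => ?_
    rw [lanTrans_fac, T.trans_refl]
    simp
  trans_comp {δ ε ζ} h₁ h₂ := by
    refine lan_hom_ext T h L η ζ _ _ fun A => ?_
    rw [lanTrans_fac, ← T.trans_comp h₁ h₂, NatTrans.comp_app, NatTrans.comp_app,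
      reassoc_of% (T.lanTrans_fac h L η h₂ A), lanTrans_fac, Functor.map_comp, Category.assoc]
  counit := T.lanCounit h L η
  comult ε δ := T.lanComult h L η ε δ
  counit_left ε X := by
    let f : L (0 + ε) ⟶ L ε :=
      T.lanComult h L η 0 ε ≫ Functor.whiskerLeft (L ε) (T.lanCounit h L η)
    refine NatTrans.congr_app (lan_hom_ext T h L η (0 + ε) f
      (T.lanTrans h L η (zero_add ε).ge) fun A => ?_) X
    have h₁ := (T.lanCounit h L η).naturality ((η ε).app A)
    simp only [Functor.id_map, Functor.comp_obj, Functor.id_obj] at h₁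
    simp only [f, NatTrans.comp_app, Functor.whiskerLeft_app]
    rw [reassoc_of% (T.lanComult_fac h L η 0 ε A), lanTrans_fac, ← T.counit_left, h₁,
      reassoc_of% (T.lanCounit_fac h L η ((T.shift ε).obj A)), Functor.map_comp, Category.assoc]
  counit_right ε X := by
    let f : L (ε + 0) ⟶ L ε :=
      T.lanComult h L η ε 0 ≫ Functor.whiskerRight (T.lanCounit h L η) (L ε)
    refine NatTrans.congr_app (lan_hom_ext T h L η (ε + 0) f
      (T.lanTrans h L η (add_zero ε).ge) fun A => ?_) X
    have h₁ := (η ε).naturality (T.counit.app A)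
    simp only [Functor.comp_map, Functor.comp_obj, Functor.id_obj] at h₁
    simp only [f, NatTrans.comp_app, Functor.whiskerRight_app]
    rw [reassoc_of% (T.lanComult_fac h L η ε 0 A), lanTrans_fac, ← T.counit_right,
      ← Functor.map_comp, lanCounit_fac, Functor.map_comp, Category.assoc, h₁]
  coassoc ε ζ δ X := by
    let f : L (ε + ζ + δ) ⟶ L δ ⋙ L ζ ⋙ L ε :=
      T.lanComult h L η (ε + ζ) δ ≫ Functor.whiskerLeft (L δ) (T.lanComult h L η ε ζ)
    let g : L (ε + ζ + δ) ⟶ L δ ⋙ L ζ ⋙ L ε :=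
      T.lanTrans h L η (add_assoc ε ζ δ).ge ≫ T.lanComult h L η ε (ζ + δ) ≫
        Functor.whiskerRight (T.lanComult h L η ζ δ) (L ε)
    refine NatTrans.congr_app (lan_hom_ext T h L η (ε + ζ + δ) f g fun A => ?_) X
    have h₁ := (T.lanComult h L η ε ζ).naturality ((η δ).app A)
    have h₂ := (η ε).naturality ((T.comult ζ δ).app A)
    simp only [Functor.comp_map, Functor.comp_obj] at h₁ h₂
    simp only [f, g, NatTrans.comp_app, Functor.whiskerRight_app, Functor.whiskerLeft_app]
    rw [reassoc_of% (T.lanComult_fac h L η (ε + ζ) δ A), h₁,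
      reassoc_of% (T.lanComult_fac h L η ε ζ ((T.shift δ).obj A)),
      reassoc_of% (T.lanTrans_fac h L η (add_assoc ε ζ δ).ge A),
      reassoc_of% (T.lanComult_fac h L η ε (ζ + δ) A), ← Functor.map_comp (L ε) ((η (ζ + δ)).app A),
      lanComult_fac, Functor.map_comp, Functor.map_comp, ← reassoc_of% h₂,
      ← reassoc_of% (h.map_comp), T.coassoc]
    simp only [Functor.map_comp, Category.assoc]
  comult_natural {ε δ ζ κ} h₁ h₂ X := by
    let f : L (δ + κ) ⟶ L ζ ⋙ L ε :=
      T.lanTrans h L η (add_le_add h₁ h₂) ≫ T.lanComult h L η ε ζ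
    let g : L (δ + κ) ⟶ L ζ ⋙ L ε :=
      T.lanComult h L η δ κ ≫ Functor.whiskerRight (T.lanTrans h L η h₂) (L δ) ≫
        Functor.whiskerLeft (L ζ) (T.lanTrans h L η h₁)
    refine NatTrans.congr_app (lan_hom_ext T h L η (δ + κ) f g fun A => ?_) X
    have h₃ := (η δ).naturality ((T.trans h₂).app A)
    have h₄ := (T.lanTrans h L η h₁).naturality ((η ζ).app A)
    simp only [Functor.comp_map, Functor.comp_obj] at h₃ h₄
    simp only [f, g, NatTrans.comp_app, Functor.whiskerRight_app, Functor.whiskerLeft_app]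
    rw [reassoc_of% (T.lanTrans_fac h L η (add_le_add h₁ h₂) A), lanComult_fac,
      reassoc_of% (T.lanComult_fac h L η δ κ A),
      ← (L δ).map_comp_assoc, lanTrans_fac, Functor.map_comp, Category.assoc, h₄,
      ← reassoc_of% h₃, reassoc_of% (T.lanTrans_fac h L η h₁ ((T.shift ζ).obj A)),
      ← h.map_comp_assoc, T.comult_natural h₁ h₂]
    simp only [Functor.map_comp, Category.assoc]

end Extension

/-- Let `h : C ⥤ D` be a functor into a category with a coflow `S`.  A full subcategory `P` of `D`
is a dense complete extension of `C` if (1) `C` is, via `h`, a full subcategory of `P`, (2) `C` is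
metrically dense in `P`, (3) the functors of `S` preserve `P`, and (4) `P` with the induced coflow
is metrically complete. -/
structure IsDenseCompleteExtension {C : Type u₁} [Category.{v₁} C] {D : Type u₂} [Category.{v₂} D]
    (h : C ⥤ D) (S : CatCoflow D) (P : ObjectProperty D) : Prop where
  contains : ∀ A : C, P (h.obj A)
  full : (P.lift h contains).Full
  faithful : (P.lift h contains).Faithful
  preserves : S.Preserves P
  dense : ∀ (Z : P.FullSubcategory) (ε : ℝ≥0), 0 < ε → ∃ A : C,
    (S.restrict P preserves).interleavingDist ((P.lift h contains).obj A) Z < ε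
  complete : (S.restrict P preserves).IsMetricallyComplete

/-- `P` is the largest among the full subcategories of `D` that are dense complete extensions of
`C`. -/
def IsMetricClosure {C : Type u₁} [Category.{v₁} C] {D : Type u₂} [Category.{v₂} D]
    (h : C ⥤ D) (S : CatCoflow D) (P : ObjectProperty D) : Prop :=
  IsGreatest {Q : ObjectProperty D | S.IsDenseCompleteExtension h Q} P

end CatCoflow

/-!
Write `S` for the coflow induced by `T` on presheaves.  The subcategory consists of the presheaves
`Z` that are limits of objects of `C`, that is, for every `ε > 0` some `h A` has distance less than
`ε` from `Z` (`CatCoflow.metricClosure`).  Any dense full subcategory is contained in it, so it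
remains to see that it is preserved by `S` and complete.

The bookkeeping is done in a graded category: a morphism `S_ε A ⟶ B` is regarded as a morphism
`A ⟶ B` of degree `ε`, and the comultiplication composes morphisms of degrees `ε` and `δ` to one of
degree `δ + ε`.  A weak `ε`-interleaving is then a pair of morphisms of degree `ε` whose composites
in both orders are identities, raised to degree `ε + ε`; the triangle inequality is immediate.

A left Kan extension along the Yoneda embedding is cocontinuous and extends the given functor
(`isLeftKanExtension_uliftYoneda_iff`).  As the comultiplications of a strict coflow are
isomorphisms, so are those of `S` (`CatCoflow.isIso_lan_comult`).  Hence `S_κ A` represents the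
morphisms out of `A` of degrees at least `κ` (`CatCoflow.existsUnique_id_gcomp`), and this has two
consequences.

* The functors `S_κ` preserve interleavings (`CatCoflow.WeaklyInterleaved.shift`).  As `S_κ (h A)` is
  isomorphic to `h (T_κ A)`, the closure of `C` is preserved by `S_κ`.
* Let `X n` and `X (n + 1)` be `e n`-interleaved for all `n`, and let `r n` be the sum of the `e k`
  with `k ≥ n`.  The interleavings give maps `S_(r n) (X n) ⟶ S_(r (n + 1)) (X (n + 1))`, and the
  colimit `Z` of this sequence is `r n`-interleaved with `X n`
  (`CatCoflow.exists_weaklyInterleaved_limit`): one map is the inclusion into the colimit, and the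
  other is given on the `m`-th term of the sequence by the backward maps `X m ⟶ ⋯ ⟶ X n`, since
  `S_(r n)` preserves the colimit.

A Cauchy sequence has a subsequence with `e n = 2 ^ (-n-1)` and `r n = 2 ^ (-n)`, so the category of
presheaves is metrically complete, and with it the closure of `C`.  The statement for a flow on `C`
is that for the opposite coflow on `Cᵒᵖ`.
-/

namespace CatCoflow

/-! ### Graded morphisms and the triangle inequality -/

section Graded

variable {D : Type u₂} [Category.{v₂} D] (S : CatCoflow D)

/-- A morphism `S_δ A ⟶ B`, regarded as a morphism `A ⟶ B` of degree `δ`, seen in a degree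
`ε ≥ δ`. -/
def raise {δ ε : ℝ≥0} (h : δ ≤ ε) {A B : D} (f : (S.shift δ).obj A ⟶ B) :
    (S.shift ε).obj A ⟶ B :=
  (S.trans h).app A ≫ f

/-- The identity of `A` as a morphism of degree `0`. -/
def gid (A : D) : (S.shift 0).obj A ⟶ A := S.counit.app A

/-- The composite, in diagrammatic order, of morphisms of degrees `ε` and `δ`. -/
def gcomp {ε δ : ℝ≥0} {A B E : D} (f : (S.shift ε).obj A ⟶ B) (g : (S.shift δ).obj B ⟶ E) :
    (S.shift (δ + ε)).obj A ⟶ E :=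
  (S.comult δ ε).app A ≫ (S.shift δ).map f ≫ g

variable {A B E F : D} {ε δ ζ κ : ℝ≥0}

@[simp]
theorem raise_refl (f : (S.shift ε).obj A ⟶ B) : S.raise le_rfl f = f := by
  simp [raise, S.trans_refl]

@[simp]
theorem raise_raise (h₁ : ε ≤ δ) (h₂ : δ ≤ ζ) (f : (S.shift ε).obj A ⟶ B) :
    S.raise h₂ (S.raise h₁ f) = S.raise (h₁.trans h₂) f := by
  simp [raise, ← S.trans_comp h₁ h₂]

@[simp]
theorem raise_gcomp_raise (h₁ : ε ≤ ζ) (h₂ : δ ≤ κ) (f : (S.shift ε).obj A ⟶ B)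
    (g : (S.shift δ).obj B ⟶ E) :
    S.gcomp (S.raise h₁ f) (S.raise h₂ g) = S.raise (add_le_add h₂ h₁) (S.gcomp f g) := by
  have h := S.comult_natural h₂ h₁ A
  simp only [raise, gcomp, Functor.map_comp, Category.assoc]
  rw [reassoc_of% h, (S.trans h₂).naturality_assoc]

@[simp]
theorem raise_gcomp (h : ε ≤ ζ) (f : (S.shift ε).obj A ⟶ B) (g : (S.shift δ).obj B ⟶ E) :
    S.gcomp (S.raise h f) g = S.raise (by gcongr) (S.gcomp f g) := by
  simpa using S.raise_gcomp_raise h (le_refl δ) f g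

@[simp]
theorem gcomp_raise (h : δ ≤ ζ) (f : (S.shift ε).obj A ⟶ B) (g : (S.shift δ).obj B ⟶ E) :
    S.gcomp f (S.raise h g) = S.raise (by gcongr) (S.gcomp f g) := by
  simpa using S.raise_gcomp_raise (le_refl ε) h f g

@[simp]
theorem gid_gcomp (f : (S.shift ε).obj A ⟶ B) :
    S.gcomp (S.gid A) f = S.raise (add_zero ε).ge f := by
  have h := S.counit_right ε A
  simp only [gcomp, gid, raise]
  rw [reassoc_of% h]

@[simp]
theorem gcomp_gid (f : (S.shift ε).obj A ⟶ B) :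
    S.gcomp f (S.gid B) = S.raise (zero_add ε).ge f := by
  have h := S.counit_left ε A
  have h' := S.counit.naturality f
  simp only [Functor.id_map] at h'
  simp only [gcomp, gid, raise]
  rw [h', reassoc_of% h]

theorem gcomp_assoc (f : (S.shift ε).obj A ⟶ B) (g : (S.shift δ).obj B ⟶ E)
    (k : (S.shift ζ).obj E ⟶ F) :
    S.gcomp (S.gcomp f g) k = S.raise (add_assoc ζ δ ε).le (S.gcomp f (S.gcomp g k)) := by
  have h := S.coassoc ζ δ ε A
  have h' := (S.comult ζ δ).naturality f
  have h'' : (S.trans (add_assoc ζ δ ε).le).app A ≫ (S.trans (add_assoc ζ δ ε).ge).app A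
      = 𝟙 _ := by
    rw [← NatTrans.comp_app, S.trans_comp, S.trans_refl]; rfl
  simp only [Functor.comp_map] at h'
  simp only [gcomp, raise, Functor.map_comp, Category.assoc]
  rw [reassoc_of% h', reassoc_of% h, reassoc_of% h'']

theorem gcomp_assoc' (f : (S.shift ε).obj A ⟶ B) (g : (S.shift δ).obj B ⟶ E)
    (k : (S.shift ζ).obj E ⟶ F) :
    S.gcomp f (S.gcomp g k) = S.raise (add_assoc ζ δ ε).ge (S.gcomp (S.gcomp f g) k) := by
  simp [gcomp_assoc]

theorem gcomp_comp (f : (S.shift ε).obj A ⟶ B) (g : (S.shift δ).obj B ⟶ E) (k : E ⟶ F) :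
    S.gcomp f (g ≫ k) = S.gcomp f g ≫ k := by simp [gcomp]

theorem raise_comp (h : ε ≤ δ) (f : (S.shift ε).obj A ⟶ B) (k : B ⟶ E) :
    S.raise h f ≫ k = S.raise h (f ≫ k) := by simp [raise]

/-- The definition of an interleaving triangle in terms of graded composition. -/
theorem interleavingTriangle_iff (α : (S.shift ε).obj A ⟶ B) (β : (S.shift ε).obj B ⟶ A) :
    S.InterleavingTriangle ε α β ↔ S.gcomp α β = S.raise bot_le (S.gid A) := Iff.rfl

variable {S}

/-- If `f g` is the identity, up to its degree, then `f g k` is `k`, up to its degree. -/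
theorem gcomp_gcomp_of_eq {f : (S.shift ε).obj A ⟶ B} {g : (S.shift δ).obj B ⟶ A}
    {k : (S.shift ζ).obj A ⟶ E} (h : S.gcomp f g = S.raise bot_le (S.gid A)) :
    S.gcomp f (S.gcomp g k) = S.raise (by rw [add_assoc]; exact le_self_add) k := by
  simp [gcomp_assoc', h]

theorem WeaklyInterleaved.mono (h : S.WeaklyInterleaved ε A B) (hδ : ε ≤ δ) :
    S.WeaklyInterleaved δ A B := by
  obtain ⟨α, β, h₁, h₂⟩ := h
  rw [interleavingTriangle_iff] at h₁ h₂
  refine ⟨S.raise hδ α, S.raise hδ β, ?_, ?_⟩ <;> rw [interleavingTriangle_iff] <;> simp [h₁, h₂]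

theorem WeaklyInterleaved.trans (h : S.WeaklyInterleaved ε A B)
    (h' : S.WeaklyInterleaved δ B E) : S.WeaklyInterleaved (ε + δ) A E := by
  obtain ⟨α, β, h₁, h₂⟩ := h
  obtain ⟨γ, κ, h₃, h₄⟩ := h'
  rw [interleavingTriangle_iff] at h₁ h₂ h₃ h₄
  refine ⟨S.raise (add_comm ε δ).ge (S.gcomp α γ), S.gcomp κ β, ?_, ?_⟩ <;>
    rw [interleavingTriangle_iff]
  · simp [gcomp_assoc, gcomp_gcomp_of_eq h₃, h₁]
  · simp [gcomp_assoc, gcomp_gcomp_of_eq h₂, h₄]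

theorem weaklyInterleaved_of_iso (i : A ≅ B) : S.WeaklyInterleaved 0 A B := by
  refine ⟨S.gid A ≫ i.hom, S.gid B ≫ i.inv, ?_, ?_⟩ <;> rw [interleavingTriangle_iff]
  · simp [gcomp_comp, raise_comp]
  · simp [gcomp_comp, raise_comp]

theorem interleavingDist_lt_iff {ε : ℝ≥0} :
    S.interleavingDist A B < ε ↔ ∃ δ < ε, S.WeaklyInterleaved δ A B := by
  simp only [interleavingDist, iInf_lt_iff, exists_prop, ENNReal.coe_lt_coe]
  exact exists_congr fun _ => and_comm

end Graded

/-! ### Colimits of sequences -/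

section Colimit

variable {D : Type u₂} [Category.{v₂} D]

/-- Morphisms out of the colimit of a sequence correspond to compatible families of morphisms out
of any tail of the sequence. -/
theorem existsUnique_desc_of_tail {F : ℕ ⥤ D} {c : Limits.Cocone F} (hc : Limits.IsColimit c)
    {B : D} (n : ℕ) (y : ∀ m, F.obj (n + m) ⟶ B)
    (hy : ∀ m, F.map (homOfLE (Nat.le_succ (n + m))) ≫ y (m + 1) = y m) :
    ∃! k : c.pt ⟶ B, ∀ m, c.ι.app (n + m) ≫ k = y m := by
  have hy' : ∀ m q (h : m ≤ q), F.map (homOfLE (Nat.add_le_add_left h n)) ≫ y q = y m := by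
    intro m q h
    induction q, h using Nat.le_induction with
    | base => simp
    | succ q h ih =>
      rw [← ih, ← hy q, ← F.map_comp_assoc]
      rfl
  let t : Limits.Cocone F :=
    { pt := B
      ι := NatTrans.ofSequence (fun m => F.map (homOfLE (Nat.le_add_left m n)) ≫ y m) fun m => by
        rw [← F.map_comp_assoc, Functor.const_obj_map, ← hy m, ← F.map_comp_assoc]
        exact (Category.comp_id _).symm }
  refine ⟨hc.desc t, fun m => ?_, fun k hk => hc.hom_ext fun m => ?_⟩
  · rw [hc.fac, ← hy' m (n + m) (Nat.le_add_left m n)]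
    rfl
  · rw [hc.fac]
    simp only [t, NatTrans.ofSequence_app]
    rw [← hk m, ← Category.assoc, c.w]

/-- A sequence has a colimit `Z` which every functor preserving sequential colimits preserves. -/
theorem exists_colimit_of_sequence [Limits.HasColimitsOfShape ℕ D] {W : ℕ → D}
    (φ : ∀ n, W n ⟶ W (n + 1)) :
    ∃ (Z : D) (i : ∀ n, W n ⟶ Z), (∀ n, φ n ≫ i (n + 1) = i n) ∧
      ∀ (G : D ⥤ D) [Limits.PreservesColimitsOfShape ℕ G] (B : D) (n : ℕ)
        (y : ∀ m, G.obj (W (n + m)) ⟶ B), (∀ m, G.map (φ (n + m)) ≫ y (m + 1) = y m) →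
        ∃! k : G.obj Z ⟶ B, ∀ m, G.map (i (n + m)) ≫ k = y m := by
  have hF : ∀ n, (Functor.ofSequence φ).map (homOfLE (Nat.le_succ n)) = φ n :=
    Functor.ofSequence_map_homOfLE_succ φ
  refine ⟨Limits.colimit (Functor.ofSequence φ), Limits.colimit.ι (Functor.ofSequence φ),
    fun n => ?_, fun G _ B n y hy => ?_⟩
  · have h := Limits.colimit.w (Functor.ofSequence φ) (homOfLE (Nat.le_succ n))
    rw [hF] at h
    exact h
  · refine existsUnique_desc_of_tail
      (Limits.isColimitOfPreserves G (Limits.colimit.isColimit (Functor.ofSequence φ))) n y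
      fun m => ?_
    have h := hy m
    rw [← hF] at h
    exact h

end Colimit
/-! ### Coflows whose comultiplications are isomorphisms -/

section Strong

variable {D : Type u₂} [Category.{v₂} D] {S : CatCoflow D}

theorem id_gcomp {A B : D} {κ ε : ℝ≥0} (f : (S.shift ε).obj ((S.shift κ).obj A) ⟶ B) :
    S.gcomp (𝟙 ((S.shift κ).obj A)) f = (S.comult ε κ).app A ≫ f := by
  simp [gcomp]

/-- If the comultiplications are isomorphisms, then `S_κ A` represents the morphisms out of `A`
whose degree is at least `κ`. -/
theorem existsUnique_id_gcomp (hS : ∀ ε δ, IsIso (S.comult ε δ)) {A B : D} {κ ε : ℝ≥0}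
    (f : (S.shift (ε + κ)).obj A ⟶ B) :
    ∃! g : (S.shift ε).obj ((S.shift κ).obj A) ⟶ B, S.gcomp (𝟙 ((S.shift κ).obj A)) g = f := by
  have := hS ε κ
  refine ⟨inv ((S.comult ε κ).app A) ≫ f, ?_, fun g hg => ?_⟩
  · simp only [id_gcomp]
    exact IsIso.hom_inv_id_assoc _ f
  · rw [← hg]
    simp only [id_gcomp]
    exact (IsIso.inv_hom_id_assoc ((S.comult ε κ).app A) g).symm

/-- The functors of the coflow preserve interleavings.  The image of `f : A ⟶ B` of degree `ε` is the
morphism `S_κ A ⟶ S_κ B` of degree `ε` that represents the composite of `f` with the universal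
morphism `B ⟶ S_κ B` of degree `κ`. -/
theorem WeaklyInterleaved.shift (hS : ∀ ε δ, IsIso (S.comult ε δ)) {A B : D} {ε : ℝ≥0}
    (h : S.WeaklyInterleaved ε A B) (κ : ℝ≥0) :
    S.WeaklyInterleaved ε ((S.shift κ).obj A) ((S.shift κ).obj B) := by
  have key : ∀ {A B : D} {f : (S.shift ε).obj A ⟶ B} {g : (S.shift ε).obj B ⟶ A}
      {f' : (S.shift ε).obj ((S.shift κ).obj A) ⟶ (S.shift κ).obj B}
      {g' : (S.shift ε).obj ((S.shift κ).obj B) ⟶ (S.shift κ).obj A},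
      S.gcomp f g = S.raise bot_le (S.gid A) →
      S.gcomp (𝟙 _) f' = S.raise (add_comm ε κ).ge (S.gcomp f (𝟙 _)) →
      S.gcomp (𝟙 _) g' = S.raise (add_comm ε κ).ge (S.gcomp g (𝟙 _)) →
      S.gcomp f' g' = S.raise bot_le (S.gid _) := by
    intro A B f g f' g' h hf hg
    refine (existsUnique_id_gcomp hS _).unique rfl ?_
    rw [gcomp_assoc', hf]
    simp [gcomp_assoc, hg, gcomp_gcomp_of_eq h]
  obtain ⟨f, g, h₁, h₂⟩ := h
  obtain ⟨f', hf', -⟩ := existsUnique_id_gcomp hS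
    (S.raise (add_comm ε κ).ge (S.gcomp f (𝟙 ((S.shift κ).obj B))))
  obtain ⟨g', hg', -⟩ := existsUnique_id_gcomp hS
    (S.raise (add_comm ε κ).ge (S.gcomp g (𝟙 ((S.shift κ).obj A))))
  exact ⟨f', g', key h₁ hf' hg', key h₂ hg' hf'⟩

/-- Compatibility of two graded morphisms `x` and `x'` with `f`, in terms of the ungraded morphisms
that represent them. -/
theorem map_raise_comp_eq (hS : ∀ ε δ, IsIso (S.comult ε δ)) {X X' B : D} {r r' e s : ℝ≥0}
    (hr : r = r' + e) {f : (S.shift e).obj X ⟶ X'} {x : (S.shift (s + r)).obj X ⟶ B}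
    {x' : (S.shift (s + r')).obj X' ⟶ B} {y : (S.shift s).obj ((S.shift r).obj X) ⟶ B}
    {y' : (S.shift s).obj ((S.shift r').obj X') ⟶ B}
    (hy : S.gcomp (𝟙 _) y = x) (hy' : S.gcomp (𝟙 _) y' = x')
    (hx : S.gcomp f x' = S.raise (by rw [hr, add_assoc]) x) :
    (S.shift s).map (S.raise hr.ge (S.gcomp f (𝟙 _))) ≫ y' = y := by
  refine (existsUnique_id_gcomp hS x).unique ?_ hy
  have h : S.gcomp (𝟙 _) ((S.shift s).map (S.raise hr.ge (S.gcomp f (𝟙 _))) ≫ y') =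
      S.gcomp (S.raise hr.ge (S.gcomp f (𝟙 _))) y' := by simp [gcomp]
  simp [h, gcomp_assoc, hy', hx]

/-- The colimit `Z` of the sequence of the `S_(r n) (X n)`, in terms of graded morphisms: a morphism
`Z ⟶ B` of degree `s` is a compatible family of morphisms `X m ⟶ B` of degrees `s + r m`, and it
suffices to give the family for `m ≥ n`. -/
theorem exists_sequentialColimit [Limits.HasColimitsOfShape ℕ D]
    [∀ ε, Limits.PreservesColimitsOfShape ℕ (S.shift ε)] (hS : ∀ ε δ, IsIso (S.comult ε δ))
    (X : ℕ → D) (r e : ℕ → ℝ≥0) (hr : ∀ n, r n = r (n + 1) + e n)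
    (f : ∀ n, (S.shift (e n)).obj (X n) ⟶ X (n + 1)) :
    ∃ (Z : D) (j : ∀ n, (S.shift (r n)).obj (X n) ⟶ Z),
      (∀ n, S.gcomp (f n) (j (n + 1)) = S.raise (hr n).le (j n)) ∧
      ∀ (s : ℝ≥0) (B : D) (n : ℕ) (x : ∀ m, (S.shift (s + r (n + m))).obj (X (n + m)) ⟶ B),
        (∀ m, S.gcomp (f (n + m)) (x (m + 1)) =
          S.raise (by rw [hr (n + m), ← add_assoc]; rfl) (x m)) →
        ∃! k : (S.shift s).obj Z ⟶ B, ∀ m, S.gcomp (j (n + m)) k = x m := by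
  let φ : ∀ n, (S.shift (r n)).obj (X n) ⟶ (S.shift (r (n + 1))).obj (X (n + 1)) :=
    fun n => S.raise (hr n).ge (S.gcomp (f n) (𝟙 ((S.shift (r (n + 1))).obj (X (n + 1)))))
  obtain ⟨Z, i, hi, hZ⟩ := exists_colimit_of_sequence φ
  refine ⟨Z, i, fun n => ?_, fun s B n x hx => ?_⟩
  · rw [← hi n]
    simp only [φ, raise_comp, raise_raise, raise_refl, ← gcomp_comp, Category.id_comp]
  · choose y hy hy' using fun m => existsUnique_id_gcomp hS (x m)
    simp only at hy hy'
    have hk := hZ (S.shift s) B n y fun m =>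
      map_raise_comp_eq hS (hr (n + m)) (hy m) (hy (m + 1)) (hx m)
    have h : ∀ (k : (S.shift s).obj Z ⟶ B) m, S.gcomp (i (n + m)) k = x m ↔
        (S.shift s).map (i (n + m)) ≫ k = y m := by
      intro k m
      have h' : S.gcomp (𝟙 _) ((S.shift s).map (i (n + m)) ≫ k) = S.gcomp (i (n + m)) k := by
        simp [gcomp]
      rw [← h']
      refine ⟨fun h => hy' m _ h, fun h => ?_⟩
      rw [h]
      exact hy m
    simpa only [h] using hk

/-- The degree of the composite of `m` consecutive morphisms of degrees `e n, e (n + 1), …`. -/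
def tailDegree (e : ℕ → ℝ≥0) (n : ℕ) : ℕ → ℝ≥0
  | 0 => 0
  | m + 1 => tailDegree e n m + e (n + m)

/-- The composite `X (n + m) ⟶ X n` of consecutive graded morphisms `X (k + 1) ⟶ X k`. -/
def back {X : ℕ → D} {e : ℕ → ℝ≥0} (g : ∀ n, (S.shift (e n)).obj (X (n + 1)) ⟶ X n) (n : ℕ) :
    ∀ m, (S.shift (tailDegree e n m)).obj (X (n + m)) ⟶ X n
  | 0 => S.gid (X n)
  | m + 1 => S.gcomp (g (n + m)) (back g n m)

theorem tailDegree_add {r e : ℕ → ℝ≥0} (hr : ∀ n, r n = r (n + 1) + e n) (n m : ℕ) :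
    tailDegree e n m + r (n + m) = r n := by
  induction m with
  | zero => simp [tailDegree]
  | succ m ih => rw [← ih, hr (n + m), tailDegree, ← add_assoc n m 1]; ring

/-- The identity `f g k = k`, up to degrees, with arbitrary bounds for the degrees involved. -/
theorem gcomp_raise_gcomp_of_eq {A B E : D} {ε δ ζ κ μ : ℝ≥0} {f : (S.shift ε).obj A ⟶ B}
    {g : (S.shift δ).obj B ⟶ A} (h : S.gcomp f g = S.raise bot_le (S.gid A))
    (k : (S.shift ζ).obj A ⟶ E) (h₁ : ζ + δ ≤ κ) (h₂ : ζ ≤ μ) (h₃ : μ ≤ κ + ε) :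
    S.gcomp f (S.raise h₁ (S.gcomp g k)) = S.raise h₃ (S.raise h₂ k) := by
  simp [gcomp_gcomp_of_eq h]

/-- If `g f` is the identity and `j = f j'`, up to degrees, then `g j = j'`, up to degrees. -/
theorem gcomp_eq_raise_of_eq {A B E : D} {ε δ ζ κ : ℝ≥0} {f : (S.shift ε).obj A ⟶ B}
    {g : (S.shift δ).obj B ⟶ A} (h : S.gcomp g f = S.raise bot_le (S.gid B))
    {j : (S.shift ζ).obj A ⟶ E} {j' : (S.shift κ).obj B ⟶ E} (hζ : ζ = κ + ε)
    (hj : S.gcomp f j' = S.raise hζ.le j) :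
    S.gcomp g j = S.raise (by rw [hζ, add_assoc]; exact le_self_add) j' := by
  have hj' : j = S.raise hζ.ge (S.gcomp f j') := by simp [hj]
  simp [hj', gcomp_gcomp_of_eq h]

/-- A sequence whose consecutive terms are interleaved has a limit if the sum of the radii is finite;
here `r n` bounds the sum of the `e k` with `k ≥ n`. -/
theorem exists_weaklyInterleaved_limit [Limits.HasColimitsOfShape ℕ D]
    [∀ ε, Limits.PreservesColimitsOfShape ℕ (S.shift ε)] (hS : ∀ ε δ, IsIso (S.comult ε δ))
    (X : ℕ → D) (r e : ℕ → ℝ≥0) (hr : ∀ n, r n = r (n + 1) + e n)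
    (h : ∀ n, S.WeaklyInterleaved (e n) (X n) (X (n + 1))) :
    ∃ Z, ∀ n, S.WeaklyInterleaved (r n) (X n) Z := by
  choose f g hfg hgf using h
  simp only [interleavingTriangle_iff] at hfg hgf
  obtain ⟨Z, j, hj, hZ⟩ := exists_sequentialColimit hS X r e hr f
  refine ⟨Z, fun n => ?_⟩
  have hd : ∀ m, tailDegree e n m ≤ r n := fun m => by
    rw [← tailDegree_add hr n m]; exact le_self_add
  have hrm : ∀ m, r (n + m) ≤ r n := fun m => by
    rw [← tailDegree_add hr n m]; exact le_add_self
  obtain ⟨k, hk, -⟩ := hZ (r n) (X n) n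
    -- The degree of the backward map is raised from `r n - r (n + m)` to `r n + r (n + m)`.
    (fun m => S.raise ((hd m).trans le_self_add) (back g n m))
    fun m => gcomp_raise_gcomp_of_eq (hfg (n + m)) _ _ _ _
  -- Mapping backward and then into the colimit is the inclusion into the colimit.
  have hback : ∀ m, S.gcomp (back g n m) (j n) =
      S.raise ((hrm m).trans le_self_add) (j (n + m)) := by
    intro m
    induction m with
    | zero => exact S.gid_gcomp (j n)
    | succ m ih =>
      refine (S.gcomp_assoc (g (n + m)) (back g n m) (j n)).trans ?_
      rw [ih, gcomp_raise,
        gcomp_eq_raise_of_eq (hgf (n + m)) (hr (n + m)) (hj (n + m)), raise_raise, raise_raise]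
      rfl
  refine ⟨j n, k, ?_, ?_⟩ <;> rw [interleavingTriangle_iff]
  · exact hk 0
  -- Two endomorphisms of the colimit are equal as they agree on the terms of the sequence.
  · refine (hZ (r n + r n) Z n (fun m => S.raise le_add_self (j (n + m))) fun m => ?_).unique
      (fun m => ?_) (fun m => ?_)
    · rw [gcomp_raise, show S.gcomp (f (n + m)) (j (n + (m + 1))) = _ from hj (n + m)]
      simp
    · rw [gcomp_assoc', hk]
      simp [hback]
    · simp

end Strong

/-! ### Metric completeness and the metric closure -/

section Closure

variable {D : Type u₂} [Category.{v₂} D] {S : CatCoflow D}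

theorem weaklyInterleaved_of_interleavingDist_lt {A B : D} {ε : ℝ≥0}
    (h : S.interleavingDist A B < ε) : S.WeaklyInterleaved ε A B := by
  obtain ⟨δ, hδ, h⟩ := interleavingDist_lt_iff.1 h
  exact h.mono hδ.le

/-- A category with sequential colimits is metrically complete for a coflow whose functors preserve
these colimits and whose comultiplications are isomorphisms. -/
theorem isMetricallyComplete [Limits.HasColimitsOfShape ℕ D]
    [∀ ε, Limits.PreservesColimitsOfShape ℕ (S.shift ε)] (hS : ∀ ε δ, IsIso (S.comult ε δ)) :
    S.IsMetricallyComplete := by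
  intro X hX
  let r : ℕ → ℝ≥0 := fun k => (1 / 2) ^ k
  have hr0 : ∀ k, 0 < r k := fun k => by positivity
  have hr : ∀ k, r k = r (k + 1) + r (k + 1) := fun k => by
    simp only [r, pow_succ, ← mul_add]
    norm_num
  choose N hN using fun k => hX (r (k + 1)) (hr0 _)
  -- Indices of a subsequence whose `k`-th and `(k + 1)`-st terms are `r (k + 1)`-interleaved.
  let p : ℕ → ℕ := fun k => ∑ i ∈ Finset.range (k + 1), N i
  have hp : ∀ k, N k ≤ p k := fun k =>
    Finset.single_le_sum (f := N) (fun _ _ => Nat.zero_le _) (Finset.self_mem_range_succ k)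
  have hp' : ∀ k, N k ≤ p (k + 1) := fun k => (hp k).trans <| by
    simp only [p, Finset.sum_range_succ N (k + 1)]
    exact Nat.le_add_right _ _
  obtain ⟨Z, hZ⟩ := exists_weaklyInterleaved_limit hS (fun k => X (p k)) r (fun k => r (k + 1)) hr
    fun k => weaklyInterleaved_of_interleavingDist_lt (hN k _ _ (hp k) (hp' k))
  refine ⟨Z, fun ε hε => ?_⟩
  obtain ⟨k, hk⟩ := exists_pow_lt_of_lt_one (half_pos hε) (show (1 / 2 : ℝ≥0) < 1 by norm_num)
  refine ⟨N k, fun n hn => interleavingDist_lt_iff.2 ⟨r (k + 1) + r k, ?_,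
    (weaklyInterleaved_of_interleavingDist_lt (hN k n _ hn.le (hp k))).trans (hZ k)⟩⟩
  have h₁ : r (k + 1) ≤ r k := by rw [hr k]; exact le_self_add
  calc r (k + 1) + r k ≤ r k + r k := by gcongr
    _ < ε / 2 + ε / 2 := add_lt_add hk hk
    _ = ε := add_halves ε

theorem restrict_weaklyInterleaved_iff {P : ObjectProperty D} (hP : S.Preserves P) {ε : ℝ≥0}
    {A B : P.FullSubcategory} :
    (S.restrict P hP).WeaklyInterleaved ε A B ↔ S.WeaklyInterleaved ε A.obj B.obj := by
  constructor
  · rintro ⟨α, β, h₁, h₂⟩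
    exact ⟨α.hom, β.hom, congrArg P.ι.map h₁, congrArg P.ι.map h₂⟩
  · rintro ⟨α, β, h₁, h₂⟩
    exact ⟨ObjectProperty.homMk α, ObjectProperty.homMk β, P.hom_ext h₁, P.hom_ext h₂⟩

theorem restrict_interleavingDist {P : ObjectProperty D} (hP : S.Preserves P)
    (A B : P.FullSubcategory) :
    (S.restrict P hP).interleavingDist A B = S.interleavingDist A.obj B.obj := by
  simp only [interleavingDist, restrict_weaklyInterleaved_iff]

variable {C : Type u₁} [Category.{v₁} C]

/-- The objects of `D` which have distance `0` from the image of `h`. -/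
def metricClosure (h : C ⥤ D) (S : CatCoflow D) : ObjectProperty D := fun Z =>
  ∀ ε : ℝ≥0, 0 < ε → ∃ A : C, S.interleavingDist (h.obj A) Z < ε

/-- The metric closure is closed under limits. -/
theorem metricClosure_of_forall {h : C ⥤ D} {Z : D} (hZ : ∀ ε : ℝ≥0, 0 < ε →
    ∃ Y, metricClosure h S Y ∧ S.interleavingDist Y Z < ε) : metricClosure h S Z := by
  intro ε hε
  obtain ⟨Y, hY, hYZ⟩ := hZ (ε / 2) (half_pos hε)
  obtain ⟨A, hA⟩ := hY (ε / 2) (half_pos hε)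
  obtain ⟨a, ha, hA⟩ := interleavingDist_lt_iff.1 hA
  obtain ⟨b, hb, hYZ⟩ := interleavingDist_lt_iff.1 hYZ
  refine ⟨A, interleavingDist_lt_iff.2 ⟨a + b, ?_, hA.trans hYZ⟩⟩
  simpa using add_lt_add ha hb

theorem metricClosure_obj (h : C ⥤ D) (S : CatCoflow D) (A : C) :
    metricClosure h S (h.obj A) := fun _ hε =>
  ⟨A, interleavingDist_lt_iff.2 ⟨0, hε, weaklyInterleaved_of_iso (Iso.refl _)⟩⟩

theorem preserves_metricClosure {h : C ⥤ D} (hS : ∀ ε δ, IsIso (S.comult ε δ))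
    (hh : ∀ (ε : ℝ≥0) (A : C), ∃ A' : C, Nonempty (h.obj A' ≅ (S.shift ε).obj (h.obj A))) :
    S.Preserves (metricClosure h S) := by
  intro κ Z hZ ε hε
  obtain ⟨A, hA⟩ := hZ ε hε
  obtain ⟨δ, hδ, hA⟩ := interleavingDist_lt_iff.1 hA
  obtain ⟨A', ⟨i⟩⟩ := hh κ A
  refine ⟨A', interleavingDist_lt_iff.2 ⟨0 + δ, by simpa using hδ, ?_⟩⟩
  exact (weaklyInterleaved_of_iso i).trans (hA.shift hS κ)

theorem isMetricClosure_metricClosure [Limits.HasColimitsOfShape ℕ D]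
    [∀ ε, Limits.PreservesColimitsOfShape ℕ (S.shift ε)] (h : C ⥤ D) [h.Full] [h.Faithful]
    (hS : ∀ ε δ, IsIso (S.comult ε δ))
    (hh : ∀ (ε : ℝ≥0) (A : C), ∃ A' : C, Nonempty (h.obj A' ≅ (S.shift ε).obj (h.obj A))) :
    S.IsMetricClosure h (metricClosure h S) := by
  have hP := preserves_metricClosure hS hh
  refine ⟨⟨metricClosure_obj h S, inferInstance, inferInstance, hP, fun Z ε hε => ?_,
    fun X hX => ?_⟩, fun Q hQ Z hZ ε hε => ?_⟩
  · obtain ⟨A, hA⟩ := Z.property ε hε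
    refine ⟨A, ?_⟩
    rw [restrict_interleavingDist]
    exact hA
  · simp only [IsCauchySeq, restrict_interleavingDist] at hX
    obtain ⟨Z, hZ⟩ := isMetricallyComplete hS (fun n => (X n).obj) hX
    refine ⟨⟨Z, metricClosure_of_forall fun ε hε => ?_⟩, fun ε hε => ?_⟩
    · obtain ⟨N, hN⟩ := hZ ε hε
      exact ⟨_, (X (N + 1)).property, hN (N + 1) (Nat.lt_succ_self N)⟩
    · simpa only [restrict_interleavingDist] using hZ ε hε
  · obtain ⟨A, hA⟩ := hQ.dense ⟨Z, hZ⟩ ε hε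
    rw [restrict_interleavingDist] at hA
    exact ⟨A, hA⟩

end Closure

end CatCoflow

/-! ### Left Kan extensions along the Yoneda embedding -/

section Kan

open Functor

theorem isLeftKanExtension_whiskerRight_of_iso {C : Type u₁} {D : Type u₂} {E : Type*}
    [Category.{v₁} C] [Category.{v₂} D] [Category* E] {h h' : C ⥤ D} (i : h ≅ h') {F : C ⥤ E}
    {L : D ⥤ E} (α : F ⟶ h ⋙ L) [L.IsLeftKanExtension α] :
    L.IsLeftKanExtension (α ≫ whiskerRight i.hom L) :=
  ⟨⟨Limits.IsInitial.isInitialIffObj (leftExtensionEquivalenceOfIso₁ i F).functor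
    (LeftExtension.mk L α) (L.isUniversalOfIsLeftKanExtension α)⟩⟩

variable {C : Type u₁} [Category.{v₁} C]

/-- The isomorphism between the Yoneda embeddings into presheaves of types in `max u₁ v₁` that lift
the types of morphisms by `u₁` and by `max u₁ v₁`. -/
def uliftYonedaIsoMax : uliftYoneda.{u₁} (C := C) ≅ uliftYoneda.{max u₁ v₁} :=
  NatIso.ofComponents fun X => NatIso.ofComponents fun Y =>
    (Equiv.ulift.trans Equiv.ulift.symm).toIso

/-- The version of `Presheaf.isLeftKanExtension_along_uliftYoneda_iff` for the Yoneda embedding that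
lifts the types of morphisms by the universe of the objects. -/
theorem isLeftKanExtension_uliftYoneda_iff {E : Type u₂} [Category.{max u₁ v₁} E]
    [Limits.HasColimitsOfSize.{v₁, max u₁ v₁} E] {F : C ⥤ E}
    (L : (Cᵒᵖ ⥤ Type (max u₁ v₁)) ⥤ E) (α : F ⟶ uliftYoneda.{u₁} ⋙ L) :
    L.IsLeftKanExtension α ↔
      IsIso α ∧ Limits.PreservesColimitsOfSize.{v₁, max u₁ v₁} L := by
  let i := uliftYonedaIsoMax (C := C)
  have key := Presheaf.isLeftKanExtension_along_uliftYoneda_iff.{max u₁ v₁} L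
    (α ≫ whiskerRight i.hom L)
  constructor
  · intro _
    have := isLeftKanExtension_whiskerRight_of_iso i α
    obtain ⟨h₁, h₂⟩ := key.1 this
    exact ⟨IsIso.of_isIso_comp_right α (whiskerRight i.hom L), h₂⟩
  · rintro ⟨_, h₂⟩
    have := key.2 ⟨inferInstance, h₂⟩
    have := isLeftKanExtension_whiskerRight_of_iso i.symm (α ≫ whiskerRight i.hom L)
    simpa [← whiskerRight_comp] using this

end Kan

namespace CatCoflow

/-! ### The coflow induced on presheaves -/

section Lan

variable {C : Type u₁} [Category.{v₁} C] (T : CatCoflow C)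
  (L : ℝ≥0 → (Cᵒᵖ ⥤ Type (max u₁ v₁)) ⥤ (Cᵒᵖ ⥤ Type (max u₁ v₁)))
  (η : ∀ ε : ℝ≥0, T.shift ε ⋙ uliftYoneda.{u₁} ⟶ uliftYoneda.{u₁} ⋙ L ε)
  [∀ ε : ℝ≥0, (L ε).IsLeftKanExtension (η ε)]

/-- The functor `L_ε L_δ` is cocontinuous and extends `h T_ε T_δ`, which is `h T_{ε+δ}`, so it is a
left Kan extension of the latter, and the comparison with `L_{ε+δ}` is an isomorphism. -/
theorem isIso_lan_comult (hT : ∀ ε δ, IsIso (T.comult ε δ)) (ε δ : ℝ≥0) :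
    IsIso ((T.lan uliftYoneda.{u₁} L η).comult ε δ) := by
  have hL := fun ε => (isLeftKanExtension_uliftYoneda_iff (L ε) (η ε)).1 inferInstance
  have hη := fun ε => (hL ε).1
  have := (hL ε).2
  have := (hL δ).2
  have := hT ε δ
  let α : T.shift (ε + δ) ⋙ uliftYoneda.{u₁} ⟶ uliftYoneda.{u₁} ⋙ L δ ⋙ L ε :=
    η (ε + δ) ≫ Functor.whiskerLeft _ (T.lanComult uliftYoneda.{u₁} L η ε δ)
  have hα : IsIso α := by
    have : ∀ A, IsIso (α.app A) := fun A => by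
      have h : α.app A = _ := T.lanComult_fac uliftYoneda.{u₁} L η ε δ A
      rw [h]
      infer_instance
    exact NatIso.isIso_of_isIso_app α
  exact (Functor.isLeftKanExtension_iff_isIso _ (η (ε + δ)) α rfl).1
    ((isLeftKanExtension_uliftYoneda_iff _ α).2 ⟨hα, inferInstance⟩)

theorem exists_isMetricClosure_lan (hT : ∀ ε δ, IsIso (T.comult ε δ)) :
    ∃ P : ObjectProperty (Cᵒᵖ ⥤ Type (max u₁ v₁)),
      (T.lan uliftYoneda.{u₁} L η).IsMetricClosure uliftYoneda.{u₁} P := by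
  have hL := fun ε => (isLeftKanExtension_uliftYoneda_iff (L ε) (η ε)).1 inferInstance
  have : ∀ ε, Limits.PreservesColimitsOfShape ℕ
      ((T.lan uliftYoneda.{u₁} L η).shift ε) := fun ε => by
    have := (hL ε).2
    have := Limits.preservesSmallestColimits_of_preservesColimits (L ε)
    exact inferInstanceAs (Limits.PreservesColimitsOfShape ℕ (L ε))
  refine ⟨_, isMetricClosure_metricClosure uliftYoneda.{u₁} (isIso_lan_comult T L η hT)
    fun ε A => ⟨(T.shift ε).obj A, ⟨?_⟩⟩⟩
  have := (hL ε).1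
  exact (asIso (η ε)).app A

end Lan

end CatCoflow

theorem mainTheorem4 {C : Type u₁} [Category.{v₁} C] :
    (∀ T : CatCoflow C, T.IsStrict →
      ∀ (L : ℝ≥0 → (Cᵒᵖ ⥤ Type (max u₁ v₁)) ⥤ (Cᵒᵖ ⥤ Type (max u₁ v₁)))
        (η : ∀ ε : ℝ≥0, T.shift ε ⋙ uliftYoneda.{u₁} ⟶ uliftYoneda.{u₁} ⋙ L ε)
        [∀ ε : ℝ≥0, (L ε).IsLeftKanExtension (η ε)],
        ∃ P : ObjectProperty (Cᵒᵖ ⥤ Type (max u₁ v₁)),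
          (T.lan uliftYoneda.{u₁} L η).IsMetricClosure uliftYoneda.{u₁} P) ∧
    (∀ T : CatFlow C, T.IsStrict →
      ∀ (L : ℝ≥0 → (Cᵒᵖᵒᵖ ⥤ Type (max u₁ v₁)) ⥤ (Cᵒᵖᵒᵖ ⥤ Type (max u₁ v₁)))
        (η : ∀ ε : ℝ≥0, T.op.shift ε ⋙ uliftYoneda.{u₁} ⟶ uliftYoneda.{u₁} ⋙ L ε)
        [∀ ε : ℝ≥0, (L ε).IsLeftKanExtension (η ε)],
        ∃ P : ObjectProperty (Cᵒᵖᵒᵖ ⥤ Type (max u₁ v₁)),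
          (T.op.lan uliftYoneda.{u₁} L η).IsMetricClosure uliftYoneda.{u₁} P) := by
  refine ⟨fun T hT L η _ => T.exists_isMetricClosure_lan L η fun ε δ => ?_,
    fun T hT L η _ => T.op.exists_isMetricClosure_lan L η fun ε δ => ?_⟩
  · rw [hT.comult_eq]
    infer_instance
  · have : IsIso (T.mult ε δ) := by
      rw [hT.mult_eq]
      infer_instance
    exact inferInstanceAs (IsIso (NatTrans.op (T.mult ε δ)))
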